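/- Theorem 3.5. Let $K$ be a field of characteristic $0$, let $n\ge 2$, let $q\in K$ be nonzero, and let $M_q(n)$ be the standard quantized matrix algebra, i.e. the associative unital $K$-algebra generated by $z_{ij}$ $(1\le i,j\le n)$ subject to the relations $$\begin{array}{ll} z_{ij}z_{ik}=q\,z_{ik}z_{ij} & (j<k),\\ z_{ij}z_{kj}=q\,z_{kj}z_{ij} & (i<k),\\ z_{ij}z_{st}=z_{st}z_{ij} & (i<s,\ t<j),\\ z_{ij}z_{st}=z_{st}z_{ij}+(q-q^{-1})z_{it}z_{sj} & (i<s,\ j<t). \end{array}$$ Enumerate the $n^2$ generators, in any order, as $z_1,z_2,\ldots,z_{n^2}$. For $1\le i_1<i_2<\cdots<i_r\le n^2$ and $U=\{z_{i_1},\ldots,z_{i_r}\}$ put $$T=\{z_{i_1}^{\alpha_1}z_{i_2}^{\alpha_2}\cdots z_{i_r}^{\alpha_r} : (\alpha_1,\ldots,\alpha_r)\in\mathbb N^r\},\qquad V(T)=K\text{-span of }T .$$ For a left module $M$ over a $K$-algebra $A$, let $$\mathrm{GK.dim}\,M=\sup_{V,F}\ \limsup_{d\to\infty}\frac{\log\dim_K(V^dF)}{\log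 d},$$ where $V$ runs over the finite-dimensional subspaces of $A$ containing $1$ and $F$ over the finite-dimensional subspaces of $M$ (with $\log 0=-\infty$, so the zero module has dimension $-\infty$). Let $L$ be a left ideal of $M_q(n)$. Then $\mathrm{GK.dim}\,M_q(n)/L\le n^2$. If furthermore $\mathrm{GK.dim}\,M_q(n)/L=m$ for a non-negative integer $m<n^2$, then $V(T)\cap L\ne\{0\}$ for every subset $U=\{z_{i_1},\ldots,z_{i_{m+1}}\}$ with $i_1<i_2<\cdots<i_{m+1}$; in particular, $V(T)\cap L\neq\{0\}$ for every $U=\{z_1,z_2,\ldots,z_s\}$ with $m+1\le s\le n^2$. -/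

import Mathlib

noncomputable section

/-- The defining relations of the standard quantized matrix algebra, on the free algebra
on the letters `Z (i, j)`. -/
inductive QMatrixRel {K : Type*} [Field K] (n : ℕ) (q : K) :
    FreeAlgebra K (Fin n × Fin n) → FreeAlgebra K (Fin n × Fin n) → Prop
  | row (i j k : Fin n) (hjk : j < k) : QMatrixRel n q
      (FreeAlgebra.ι K (i, j) * FreeAlgebra.ι K (i, k))
      (q • (FreeAlgebra.ι K (i, k) * FreeAlgebra.ι K (i, j)))
  | col (i k j : Fin n) (hik : i < k) : QMatrixRel n q
      (FreeAlgebra.ι K (i, j) * FreeAlgebra.ι K (k, j))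
      (q • (FreeAlgebra.ι K (k, j) * FreeAlgebra.ι K (i, j)))
  | anti (i j s t : Fin n) (his : i < s) (htj : t < j) : QMatrixRel n q
      (FreeAlgebra.ι K (i, j) * FreeAlgebra.ι K (s, t))
      (FreeAlgebra.ι K (s, t) * FreeAlgebra.ι K (i, j))
  | diag (i j s t : Fin n) (his : i < s) (hjt : j < t) : QMatrixRel n q
      (FreeAlgebra.ι K (i, j) * FreeAlgebra.ι K (s, t))
      (FreeAlgebra.ι K (s, t) * FreeAlgebra.ι K (i, j)
        + (q - q⁻¹) • (FreeAlgebra.ι K (i, t) * FreeAlgebra.ι K (s, j)))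

/-- The standard quantized matrix algebra `M_q(n)` over `K`: the quotient of the free algebra
by the two-sided ideal generated by the defining relations. -/
abbrev QMatrixAlgebra {K : Type*} [Field K] (n : ℕ) (q : K) : Type _ :=
  RingQuot (QMatrixRel n q)

/-- The generator `z_{ij}` of `M_q(n)`, where `p = (i, j)`. -/
def QMatrixAlgebra.gen {K : Type*} [Field K] (n : ℕ) (q : K) (p : Fin n × Fin n) :
    QMatrixAlgebra n q :=
  RingQuot.mkAlgHom K (QMatrixRel n q) (FreeAlgebra.ι K p)

/-- The `K`-subspace `W F` of `M` spanned by the elements `w • x` with `w ∈ W`, `x ∈ F`. -/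
def smulSpan {K A M : Type*} [Field K] [Ring A] [Algebra K A] [AddCommGroup M] [Module K M]
    [Module A M] (W : Submodule K A) (F : Submodule K M) : Submodule K M :=
  Submodule.span K {y : M | ∃ w ∈ W, ∃ x ∈ F, y = w • x}

/-- The Gelfand-Kirillov dimension of a left module `M` over a `K`-algebra `A`:
the supremum, over the finite-dimensional subspaces `V` of `A` containing `1` and the
finite-dimensional subspaces `F` of `M`, of `limsup_d log (dim_K (V ^ d F)) / log d`.
Here `log 0 = -∞`, so that the zero module has dimension `-∞`. -/
def gkDim (K A M : Type*) [Field K] [Ring A] [Algebra K A] [AddCommGroup M] [Module K M]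
    [Module A M] [IsScalarTower K A M] : EReal :=
  ⨆ (V : Submodule K A) (_ : V.FG) (_ : (1 : A) ∈ V) (F : Submodule K M) (_ : F.FG),
    Filter.limsup
      (fun d : ℕ => ENNReal.log (Module.finrank K (smulSpan (V ^ d) F) : ENNReal)
        / ((Real.log d : ℝ) : EReal))
      Filter.atTop

/-- The subspace `V(T)` spanned by the set `T` of ordered monomials
`a₁ ^ α₁ * a₂ ^ α₂ * ⋯ * a_r ^ α_r`, `α ∈ ℕ ^ r`. -/
def orderedMonomialSpan (K : Type*) {A : Type*} [Field K] [Ring A] [Algebra K A] {r : ℕ}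
    (a : Fin r → A) : Submodule K A :=
  Submodule.span K
    (Set.range fun α : Fin r → ℕ => (List.ofFn fun k : Fin r => a k ^ α k).prod)

end

/-! The upper bound is a rewriting argument. Two generators commute up to a scalar and a correction
of the same length but smaller weight, where `z_ij` has weight `i * j`. Every word therefore reduces
to one chosen word per multiset of letters (`word_mem_span`), and the words of length at most `d`
span a space of dimension at most `(d + 1) ^ (n ^ 2)`.

For the second claim, suppose that `V(T)` meets `L` trivially for `r` generators. If the elements of
`T` are linearly independent, they stay so modulo `L`; the `d ^ r` of them with exponents below `d`
then force the quotient to have dimension at least `r` (`le_gkDim_quotient`), so `r ≤ m`.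

The crux is this independence for an arbitrary order of the generators
(`linearIndependent_monomials`). The algebra is mapped to a quantum torus, where leading exponents
add under multiplication whatever the order of the factors. The map comes from triangular quantum
matrices with mutually commuting entries, multiplied together (`IsQuantumMatrix.mul`) while one row
at a time is adjoined, so that the entries get independent leading exponents
(`exists_torus_quantumMatrix`). -/

noncomputable section

/-! ### Quantum tori -/

section QuantumTorus

variable {K : Type*} [Field K] {I : Type*} [Fintype I] [DecidableEq I]

/-- A family of linearly independent elements `op u`, `u ∈ ℤ ^ I`, of `B` that multiply as
`op u * op v = q ^ β(u, v) op (u + v)`, where `β` is the bilinear form with matrix `b`. -/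
structure QuantumTorus (q : K) (b : Matrix I I ℤ) (B : Type*) [Ring B] [Algebra K B] where
  /-- The monomial with exponent `u`. -/
  op : (I → ℤ) → B
  op_zero : op 0 = 1
  op_mul : ∀ u v, op u * op v = q ^ (Matrix.toBilin' b u v) • op (u + v)
  /-- The coefficient of `op v` in a linear combination. -/
  coeff : (I → ℤ) → B →ₗ[K] K
  coeff_op : ∀ u v, coeff v (op u) = if u = v then 1 else 0

/-- The operator `e_x ↦ q ^ β(u, x) e_{u + x}` on the space with basis `e_x`, `x ∈ ℤ ^ I`, where
`β` is the bilinear form with matrix `b`. -/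
def torusOp (q : K) (b : Matrix I I ℤ) (u : I → ℤ) : Module.End K ((I → ℤ) →₀ K) :=
  Finsupp.lsum K fun x => q ^ (Matrix.toBilin' b u x) • Finsupp.lsingle (u + x)

theorem torusOp_single (q : K) (b : Matrix I I ℤ) (u x : I → ℤ) (a : K) :
    torusOp q b u (Finsupp.single x a)
      = Finsupp.single (u + x) (q ^ (Matrix.toBilin' b u x) * a) := by
  simp [torusOp]

theorem torusOp_zero (q : K) (b : Matrix I I ℤ) : torusOp q b 0 = 1 := by
  refine Finsupp.lhom_ext fun x a => ?_
  simp [torusOp_single]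

/-- Bilinearity of `β`: both sides scale `e_x` by `q` to the power `β(u, v) + β(u, x) + β(v, x)`. -/
theorem torusOp_mul {q : K} (hq : q ≠ 0) (b : Matrix I I ℤ) (u v : I → ℤ) :
    torusOp q b u * torusOp q b v = q ^ (Matrix.toBilin' b u v) • torusOp q b (u + v) := by
  refine Finsupp.lhom_ext fun x a => ?_
  rw [Module.End.mul_apply, LinearMap.smul_apply, torusOp_single, torusOp_single, torusOp_single,
    Finsupp.smul_single, smul_eq_mul, add_assoc, map_add, map_add, LinearMap.add_apply,
    ← mul_assoc, ← mul_assoc, ← zpow_add₀ hq, ← zpow_add₀ hq]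
  congr 3
  ring

/-- Quantum tori exist, as operators on group algebras. -/
theorem exists_quantumTorus.{v₁, v₂} {K : Type v₁} [Field K] {I : Type v₂} [Fintype I] [DecidableEq I]
    {q : K} (hq : q ≠ 0) (b : Matrix I I ℤ) :
    ∃ (B : Type (max v₁ v₂)) (_ : Ring B) (_ : Algebra K B), Nonempty (QuantumTorus q b B) :=
  ⟨Module.End K ((I → ℤ) →₀ K), inferInstance, inferInstance,
    ⟨{op := torusOp q b
      op_zero := torusOp_zero q b
      op_mul := torusOp_mul hq b
      -- Evaluating at `e_0` recovers the exponent, because `β(u, 0) = 0`.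
      coeff := fun v => Finsupp.lapply v ∘ₗ LinearMap.applyₗ (Finsupp.single 0 1)
      coeff_op := fun u v => by simp [torusOp_single, Finsupp.single_apply]}⟩⟩

variable {B : Type*} [Ring B] [Algebra K B] {q : K} {b : Matrix I I ℤ}

namespace QuantumTorus

/-- The combinations of monomials `t.op u` of weight less than `d`. -/
def lower (t : QuantumTorus q b B) (w : (I → ℤ) →+ ℤ) (d : ℤ) :
    Submodule K B :=
  Submodule.span K (t.op '' {u | w u < d})

theorem lower_mono (t : QuantumTorus q b B) (w : (I → ℤ) →+ ℤ) {d d' : ℤ} (h : d ≤ d') :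
    t.lower w d ≤ t.lower w d' :=
  Submodule.span_mono (Set.image_mono fun _ hu => lt_of_lt_of_le hu h)

theorem op_mem_lower (t : QuantumTorus q b B) (w : (I → ℤ) →+ ℤ) {d : ℤ} {u : I → ℤ}
    (h : w u < d) : t.op u ∈ t.lower w d :=
  Submodule.subset_span ⟨u, h, rfl⟩

theorem coeff_of_mem_lower {t : QuantumTorus q b B} {w : (I → ℤ) →+ ℤ} {d : ℤ}
    {v : I → ℤ} (hv : d ≤ w v) {Z : B}
    (hZ : Z ∈ t.lower w d) : t.coeff v Z = 0 := by
  have : t.lower w d ≤ LinearMap.ker (t.coeff v) := by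
    refine Submodule.span_le.2 ?_
    rintro _ ⟨u, hu, rfl⟩
    have hne : u ≠ v := by
      rintro rfl
      exact absurd hu (not_lt.2 hv)
    simp [t.coeff_op, hne]
  exact this hZ

/-- Weights are integers, so the bound `d + 1` means weight at most `d`: one strict inequality in a
product is enough for a strict bound. -/
theorem mul_mem_lower {t : QuantumTorus q b B} {w : (I → ℤ) →+ ℤ} {d d' : ℤ}
    {Z Z' : B} (hZ : Z ∈ t.lower w (d + 1))
    (hZ' : Z' ∈ t.lower w d') : Z * Z' ∈ t.lower w (d + d') := by
  have h := Submodule.mul_mem_mul hZ hZ'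
  rw [lower, lower, Submodule.span_mul_span] at h
  refine Submodule.span_le.2 ?_ h
  rintro _ ⟨_, ⟨u, hu, rfl⟩, _, ⟨v, hv, rfl⟩, rfl⟩
  simp only [Set.mem_ofPred_eq] at hu hv
  simp only [t.op_mul]
  refine Submodule.smul_mem _ _ (op_mem_lower t w ?_)
  rw [map_add]
  omega

theorem mul_mem_lower' {t : QuantumTorus q b B} {w : (I → ℤ) →+ ℤ} {d d' : ℤ}
    {Z Z' : B} (hZ : Z ∈ t.lower w d)
    (hZ' : Z' ∈ t.lower w (d' + 1)) : Z * Z' ∈ t.lower w (d + d') := by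
  have h := mul_mem_lower (d := d - 1) (d' := d' + 1) (by simpa using hZ) hZ'
  convert h using 2
  ring

end QuantumTorus

open QuantumTorus

/-- `Z` is a nonzero multiple of `t.op v` plus terms of smaller weight. -/
def HasLead (t : QuantumTorus q b B) (w : (I → ℤ) →+ ℤ)
    (Z : B) (v : I → ℤ) : Prop :=
  ∃ c : K, c ≠ 0 ∧ Z - c • t.op v ∈ t.lower w (w v)

namespace HasLead

variable {t : QuantumTorus q b B} {w : (I → ℤ) →+ ℤ} {Z Z' : B}
  {v v' : I → ℤ}

theorem op (t : QuantumTorus q b B) (w : (I → ℤ) →+ ℤ) (v : I → ℤ) :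
    HasLead t w (t.op v) v :=
  ⟨1, one_ne_zero, by simp⟩

theorem mem_lower (h : HasLead t w Z v) {d : ℤ} (hd : w v < d) :
    Z ∈ t.lower w d := by
  obtain ⟨c, -, h⟩ := h
  have := Submodule.add_mem _ (lower_mono t w hd.le h)
    (Submodule.smul_mem _ c (op_mem_lower t w hd))
  simpa using this

theorem add_lower (h : HasLead t w Z v) (h' : Z' ∈ t.lower w (w v)) :
    HasLead t w (Z + Z') v := by
  obtain ⟨c, hc, h⟩ := h
  refine ⟨c, hc, ?_⟩
  have := Submodule.add_mem _ h h'
  rwa [sub_add_eq_add_sub] at this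

theorem mul (hq : q ≠ 0) (h : HasLead t w Z v) (h' : HasLead t w Z' v') :
    HasLead t w (Z * Z') (v + v') := by
  have hZ := h.mem_lower (lt_add_one _)
  obtain ⟨c, hc, h⟩ := h
  obtain ⟨c', hc', h'⟩ := h'
  have h1 := mul_mem_lower hZ h'
  have h2 := mul_mem_lower' h
    (Submodule.smul_mem _ c' (op_mem_lower t w (lt_add_one (w v'))))
  -- The remainder splits as `Z * (Z' - c' • t.op v') + (Z - c • t.op v) * (c' • t.op v')`.
  refine ⟨c * c' * q ^ (Matrix.toBilin' b v v'),
    mul_ne_zero (mul_ne_zero hc hc') (zpow_ne_zero _ hq), ?_⟩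
  rw [map_add]
  convert Submodule.add_mem _ h1 h2 using 1
  rw [mul_sub, sub_mul, smul_mul_smul_comm, t.op_mul, smul_smul]
  abel

theorem one (t : QuantumTorus q b B) (w : (I → ℤ) →+ ℤ) : HasLead t w 1 0 := by
  rw [← t.op_zero]
  exact HasLead.op t w 0

theorem pow (hq : q ≠ 0) (h : HasLead t w Z v) (k : ℕ) : HasLead t w (Z ^ k) (k • v) := by
  induction k with
  | zero => simpa using one t w
  | succ k ih =>
    rw [pow_succ, succ_nsmul]
    exact ih.mul hq h

/-- The sum on the right does not see the order of the factors; this is why any enumeration of the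
generators is allowed. -/
theorem prod_ofFn (hq : q ≠ 0) {r : ℕ} {Z : Fin r → B}
    {v : Fin r → I → ℤ} (h : ∀ k, HasLead t w (Z k) (v k)) :
    HasLead t w (List.ofFn Z).prod (∑ k, v k) := by
  induction r with
  | zero => simpa using one t w
  | succ r ih =>
    rw [List.ofFn_succ, List.prod_cons, Fin.sum_univ_succ]
    exact (h 0).mul hq (ih fun k => h k.succ)

/-- Elements with pairwise distinct leading exponents are linearly independent. -/
theorem linearIndependent {S : Type*} {Z : S → B} {v : S → I → ℤ}
    (hv : Function.Injective v) (h : ∀ s, HasLead t w (Z s) (v s)) :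
    LinearIndependent K Z := by
  rw [linearIndependent_iff]
  intro g hg
  by_contra hne
  obtain ⟨s, hs, hmax⟩ := Finset.exists_max_image g.support (fun s => w (v s))
    (Finsupp.support_nonempty_iff.2 hne)
  -- Several terms may share the maximal weight, but their leading exponents differ, so only `Z s`
  -- contributes at `v s`.
  have key : ∀ s' ∈ g.support, s' ≠ s → t.coeff (v s) (Z s') = 0 := by
    intro s' ht hts
    obtain ⟨c, -, hc⟩ := h s'
    have h0 := coeff_of_mem_lower (hmax _ ht) hc
    rw [map_sub, map_smul, t.coeff_op, if_neg (fun e => hts (hv e))] at h0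
    simpa using h0
  have := congrArg ((t.coeff (v s))) hg
  rw [Finsupp.linearCombination_apply, Finsupp.sum, map_sum, map_zero,
    Finset.sum_eq_single_of_mem s hs (fun _ ht hts => by rw [map_smul, key _ ht hts, smul_zero])]
    at this
  obtain ⟨c, hc0, hc⟩ := h s
  have h0 := coeff_of_mem_lower le_rfl hc
  rw [map_sub, map_smul, t.coeff_op, if_pos rfl, sub_eq_zero] at h0
  rw [map_smul, h0] at this
  simp only [smul_eq_mul, mul_one, mul_eq_zero, hc0, or_false] at this
  exact (Finsupp.mem_support_iff.1 hs) this

end HasLead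

end QuantumTorus

/-! ### Quantum matrices over an arbitrary algebra -/

section QuantumMatrix

variable {K : Type*} [Field K] {B : Type*} [Ring B] [Algebra K B]
  {ι κ μ : Type*} [LinearOrder ι] [LinearOrder κ] [LinearOrder μ]

/-- The entries of `X` satisfy the defining relations of quantized matrices. -/
structure IsQuantumMatrix (q : K) (X : Matrix ι κ B) : Prop where
  row : ∀ i j k, j < k → X i j * X i k = q • (X i k * X i j)
  col : ∀ i k j, i < k → X i j * X k j = q • (X k j * X i j)
  anti : ∀ i j s t, i < s → t < j → X i j * X s t = X s t * X i j
  diag : ∀ i j s t, i < s → j < t →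
    X i j * X s t = X s t * X i j + (q - q⁻¹) • (X i t * X s j)

/-- The `R`-matrix attached to the index set `ι`. -/
def rMatrix (B : Type*) [Ring B] [Algebra K B] (ι : Type*) [LinearOrder ι] (q : K) :
    Matrix (ι × ι) (ι × ι) B :=
  Matrix.of fun p a => algebraMap K B
    ((if a = p.swap then (if p.1 = p.2 then q else 1) else 0)
      + (if a = p then (if p.1 < p.2 then q - q⁻¹ else 0) else 0))

/-- The matrix of products of two entries of `X`. -/
def entryProducts (X : Matrix ι κ B) : Matrix (ι × ι) (κ × κ) B :=
  Matrix.of fun p a => X p.1 a.1 * X p.2 a.2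

theorem rMatrix_mul_entryProducts [Fintype ι] (q : K) (X : Matrix ι κ B) (i s : ι) (j t : κ) :
    (rMatrix B ι q * entryProducts X) (i, s) (j, t)
      = (if i = s then q else 1) • (X s j * X i t)
        + (if i < s then q - q⁻¹ else 0) • (X i j * X s t) := by
  simp only [Matrix.mul_apply, rMatrix, entryProducts, Matrix.of_apply, map_add, add_mul,
    Finset.sum_add_distrib, apply_ite (algebraMap K B), map_zero, ite_mul, zero_mul,
    Finset.sum_ite_eq', Finset.mem_univ, if_true, Prod.swap]
  simp only [Algebra.smul_def, apply_ite (algebraMap K B), map_zero, ite_mul, zero_mul]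

theorem entryProducts_mul_rMatrix [Fintype κ] (q : K) (X : Matrix ι κ B) (i s : ι) (j t : κ) :
    (entryProducts X * rMatrix B κ q) (i, s) (j, t)
      = (if j = t then q else 1) • (X i t * X s j)
        + (if j < t then q - q⁻¹ else 0) • (X i j * X s t) := by
  have hsw : ∀ a : κ × κ, ((j, t) = a.swap) ↔ (a = (t, j)) := by
    rintro ⟨a, b⟩
    simp only [Prod.swap, Prod.mk.injEq]
    tauto
  have hsw' : ∀ a : κ × κ, ((j, t) = a) ↔ (a = (j, t)) := fun a => eq_comm
  simp only [Matrix.mul_apply, rMatrix, entryProducts, Matrix.of_apply, map_add, mul_add,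
    Finset.sum_add_distrib, apply_ite (algebraMap K B), map_zero, mul_ite, mul_zero, hsw, hsw',
    Finset.sum_ite_eq', Finset.mem_univ, if_true]
  simp only [Algebra.smul_def, apply_ite (algebraMap K B), map_zero, ite_mul, zero_mul,
    ← Algebra.commutes, eq_comm (a := t) (b := j)]

/-- The defining relations, read entry by entry, are the intertwining relation with the `R`-matrix;
the nine cases compare the two rows and the two columns. This form is the one compatible with matrix
products. -/
theorem IsQuantumMatrix.rMatrix_comm [Fintype ι] [Fintype κ] {q : K} (hq : q ≠ 0)
    {X : Matrix ι κ B} (hX : IsQuantumMatrix q X) :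
    rMatrix B ι q * entryProducts X = entryProducts X * rMatrix B κ q := by
  ext ⟨i, s⟩ ⟨j, t⟩
  rw [rMatrix_mul_entryProducts, entryProducts_mul_rMatrix]
  rcases lt_trichotomy i s with his | rfl | his <;> rcases lt_trichotomy j t with hjt | rfl | hjt
  · simp only [his, hjt, his.ne, hjt.ne, if_true, if_false, one_smul]
    rw [hX.anti i t s j his hjt]
  · simp only [his, his.ne, lt_irrefl, if_true, if_false, one_smul, zero_smul, add_zero]
    rw [hX.col i s j his, smul_smul, sub_mul, inv_mul_cancel₀ hq, sub_smul, smul_smul]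
    simp
  · simp only [his, his.ne, hjt.ne', hjt.not_gt, if_true, if_false, one_smul, zero_smul, add_zero]
    rw [hX.diag i t s j his hjt]
  · simp only [hjt, hjt.ne, lt_irrefl, if_true, if_false, one_smul, zero_smul, add_zero]
    rw [hX.row i j t hjt, smul_smul, smul_smul, sub_mul, inv_mul_cancel₀ hq, sub_smul]
    simp
  · simp
  · simp only [hjt.ne', hjt.not_gt, lt_irrefl, if_true, if_false, one_smul, zero_smul, add_zero]
    rw [hX.row i t j hjt]
  · simp only [hjt, his.ne', hjt.ne, his.not_gt, if_true, if_false, one_smul, zero_smul, add_zero]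
    rw [hX.diag s j i t his hjt, hX.anti s t i j his hjt]
  · simp only [his.ne', his.not_gt, lt_irrefl, if_true, if_false, one_smul, zero_smul, add_zero]
    rw [hX.col s i j his]
  · simp only [his.ne', hjt.ne', his.not_gt, hjt.not_gt, if_false, one_smul, zero_smul, add_zero]
    rw [hX.anti s j i t his hjt]

theorem isQuantumMatrix_of_rMatrix_comm [Fintype ι] [Fintype κ] {q : K}
    {X : Matrix ι κ B}
    (h : rMatrix B ι q * entryProducts X = entryProducts X * rMatrix B κ q) :
    IsQuantumMatrix q X := by
  have key := fun i s j t => congrFun (congrFun h (i, s)) (j, t)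
  simp only [rMatrix_mul_entryProducts, entryProducts_mul_rMatrix] at key
  refine ⟨fun i j k hjk => ?_, fun i k j hik => ?_, fun i j s t his htj => ?_,
    fun i j s t his hjt => ?_⟩
  · have := key i i k j
    simp only [hjk.ne', hjk.not_gt, lt_irrefl, if_true, if_false, one_smul, zero_smul,
      add_zero] at this
    exact this.symm
  · have := key k i j j
    simp only [hik.ne', hik.not_gt, lt_irrefl, if_true, if_false, one_smul, zero_smul,
      add_zero] at this
    exact this
  · have := key i s t j
    simp only [his, htj, his.ne, htj.ne, if_true, if_false, one_smul] at this
    exact (add_right_cancel this).symm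
  · have := key i s t j
    simp only [his, his.ne, hjt.ne', hjt.not_gt, if_true, if_false, one_smul, zero_smul,
      add_zero] at this
    exact this.symm

/-- When entries of `X` commute with entries of `Y`, `entryProducts` is multiplicative, and the
`R`-matrix can be moved through `X` and then through `Y`. -/
theorem IsQuantumMatrix.mul [Fintype ι] [Fintype κ] [Fintype μ] {q : K} (hq : q ≠ 0)
    {X : Matrix ι κ B} {Y : Matrix κ μ B} (hX : IsQuantumMatrix q X) (hY : IsQuantumMatrix q Y)
    (hXY : ∀ i k l j, Commute (X i k) (Y l j)) : IsQuantumMatrix q (X * Y) := by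
  have hprod : entryProducts (X * Y) = entryProducts X * entryProducts Y := by
    ext ⟨i, s⟩ ⟨j, t⟩
    simp only [entryProducts, Matrix.of_apply, Matrix.mul_apply, Finset.sum_mul_sum,
      Fintype.sum_prod_type]
    refine Finset.sum_congr rfl fun k _ => Finset.sum_congr rfl fun l _ => ?_
    rw [mul_assoc, mul_assoc, ← mul_assoc (Y k j), (hXY s l k j).symm.eq, mul_assoc]
  apply isQuantumMatrix_of_rMatrix_comm
  rw [hprod, ← Matrix.mul_assoc, hX.rMatrix_comm hq, Matrix.mul_assoc, hY.rMatrix_comm hq,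
    Matrix.mul_assoc]

end QuantumMatrix

/-! ### A quantum matrix with entries in a quantum torus -/

section TorusModel

/-- The index set of the torus variables `c p k` (left) and `r p j` (right). -/
abbrev PathIndex (n : ℕ) : Type := Fin n × (Fin (n + 1) ⊕ Fin (n + 1))

/-- The commutation form of the torus variables: variables with different first index commute. -/
def pathForm (n : ℕ) : Matrix (PathIndex n) (PathIndex n) ℤ :=
  Matrix.of fun x y => if x.1 = y.1 then
    Sum.elim
      (fun k => Sum.elim (fun s => if k < s then 1 else 0) (fun t => if k < t then -2 else 0) y.2)
      (fun j => Sum.elim (fun _ => 0) (fun t => if j < t then 1 else 0) y.2) x.2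
    else 0

/-- The weight with `c p k ↦ -k` and `r p j ↦ 0`. -/
def pathWeight (n : ℕ) : (PathIndex n → ℤ) →+ ℤ where
  toFun u := u ⬝ᵥ fun x => Sum.elim (fun k : Fin (n + 1) => -(k : ℤ)) (fun _ => 0) x.2
  map_zero' := zero_dotProduct _
  map_add' u v := add_dotProduct u v _

/-- The exponent of `c p k * r p j`. -/
def stepExp {n : ℕ} (p : Fin n) (k j : Fin (n + 1)) : PathIndex n → ℤ :=
  Pi.single (p, Sum.inl k) 1 + Pi.single (p, Sum.inr j) 1

theorem pathWeight_stepExp {n : ℕ} (p : Fin n) (k j : Fin (n + 1)) :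
    pathWeight n (stepExp p k j) = -(k : ℤ) := by
  simp [pathWeight, stepExp, add_dotProduct]

/-- The `-2` occurs exactly when the cross position `(k, t)` lies above the diagonal, where
`stepMatrix` vanishes. -/
theorem pathForm_stepExp {n : ℕ} (p : Fin n) (k j s t : Fin (n + 1)) :
    Matrix.toBilin' (pathForm n) (stepExp p k j) (stepExp p s t)
      = (if k < s then 1 else 0) + (if k < t then -2 else 0) + (if j < t then 1 else 0) := by
  simp only [stepExp, map_add, LinearMap.add_apply, Matrix.toBilin'_single]
  simp [pathForm]
  ring

theorem pathForm_stepExp_left {n : ℕ} (p : Fin n) (k j : Fin (n + 1)) {u : PathIndex n → ℤ}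
    (hu : ∀ a, u (p, a) = 0) : Matrix.toBilin' (pathForm n) (stepExp p k j) u = 0 := by
  rw [Matrix.toBilin'_apply]
  refine Finset.sum_eq_zero fun x _ => Finset.sum_eq_zero fun y _ => ?_
  by_cases hy : y.1 = p
  · rw [show y = (p, y.2) from Prod.ext hy rfl, hu, mul_zero]
  · by_cases hx : x.1 = p
    · have : x.1 ≠ y.1 := fun h => hy (h.symm.trans hx)
      simp [pathForm, this]
    · have h : ∀ a, x ≠ (p, a) := fun a h => hx (congrArg Prod.fst h)
      simp [stepExp, h]

theorem pathForm_stepExp_right {n : ℕ} (p : Fin n) (k j : Fin (n + 1)) {u : PathIndex n → ℤ}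
    (hu : ∀ a, u (p, a) = 0) : Matrix.toBilin' (pathForm n) u (stepExp p k j) = 0 := by
  rw [Matrix.toBilin'_apply]
  refine Finset.sum_eq_zero fun y _ => Finset.sum_eq_zero fun x _ => ?_
  by_cases hy : y.1 = p
  · rw [show y = (p, y.2) from Prod.ext hy rfl, hu, zero_mul, zero_mul]
  · by_cases hx : x.1 = p
    · have : y.1 ≠ x.1 := fun h => hy (h.trans hx)
      simp [pathForm, this]
    · have h : ∀ a, x ≠ (p, a) := fun a h => hx (congrArg Prod.fst h)
      simp [stepExp, h]

theorem stepExp_add_comm {n : ℕ} (p : Fin n) (k j s t : Fin (n + 1)) :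
    stepExp p s t + stepExp p k j = stepExp p k j + stepExp p s t := add_comm _ _

theorem stepExp_add_cross {n : ℕ} (p : Fin n) (k j s t : Fin (n + 1)) :
    stepExp p k t + stepExp p s j = stepExp p k j + stepExp p s t := by
  simp only [stepExp]
  abel

variable {K : Type*} [Field K] {B : Type*} [Ring B] [Algebra K B] {q : K} {n : ℕ}

/-- The lower triangular matrix with entries `c p k * r p j` and last column zero. -/
def stepMatrix (t : QuantumTorus q (pathForm n) B) (p : Fin n) :
    Matrix (Fin (n + 1)) (Fin (n + 1)) B :=
  Matrix.of fun k j => if j ≤ k ∧ j ≠ Fin.last n then t.op (stepExp p k j) else 0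

theorem stepMatrix_mul (T : QuantumTorus q (pathForm n) B) (p : Fin n) (k j s t : Fin (n + 1)) :
    stepMatrix T p k j * stepMatrix T p s t =
      if (j ≤ k ∧ j ≠ Fin.last n) ∧ (t ≤ s ∧ t ≠ Fin.last n) then
        q ^ ((if k < s then 1 else 0) + (if k < t then -2 else 0) + (if j < t then 1 else 0) : ℤ)
          • T.op (stepExp p k j + stepExp p s t)
      else 0 := by
  simp only [stepMatrix, Matrix.of_apply]
  by_cases h1 : j ≤ k ∧ j ≠ Fin.last n
  · by_cases h2 : t ≤ s ∧ t ≠ Fin.last n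
    · rw [if_pos h1, if_pos h2, if_pos ⟨h1, h2⟩, T.op_mul, pathForm_stepExp]
    · rw [if_neg h2, mul_zero, if_neg]
      exact fun h => h2 h.2
  · rw [if_neg h1, zero_mul, if_neg]
    exact fun h => h1 h.1

theorem isQuantumMatrix_stepMatrix (hq : q ≠ 0) (T : QuantumTorus q (pathForm n) B) (p : Fin n) :
    IsQuantumMatrix q (stepMatrix T p) := by
  refine ⟨fun i j k hjk => ?_, fun i k j hik => ?_, fun i j s t his htj => ?_,
    fun i j s t his hjt => ?_⟩
  · rw [stepMatrix_mul, stepMatrix_mul, stepExp_add_comm p i j i k]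
    by_cases h : (j ≤ i ∧ j ≠ Fin.last n) ∧ (k ≤ i ∧ k ≠ Fin.last n)
    · rw [if_pos h, if_pos h.symm, smul_smul, if_pos hjk, if_neg hjk.not_gt,
        if_neg h.1.1.not_gt, if_neg h.2.1.not_gt]
      simp
    · rw [if_neg h, if_neg (fun h' => h h'.symm), smul_zero]
  · rw [stepMatrix_mul, stepMatrix_mul, stepExp_add_comm p i j k j]
    by_cases h : (j ≤ i ∧ j ≠ Fin.last n) ∧ (j ≤ k ∧ j ≠ Fin.last n)
    · rw [if_pos h, if_pos h.symm, smul_smul, if_pos hik, if_neg hik.not_gt,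
        if_neg h.1.1.not_gt, if_neg h.2.1.not_gt]
      simp
    · rw [if_neg h, if_neg (fun h' => h h'.symm), smul_zero]
  · rw [stepMatrix_mul, stepMatrix_mul, stepExp_add_comm p i j s t]
    by_cases h : (j ≤ i ∧ j ≠ Fin.last n) ∧ (t ≤ s ∧ t ≠ Fin.last n)
    · rw [if_pos h, if_pos h.symm, if_pos his, if_neg his.not_gt, if_pos htj, if_neg htj.not_gt,
        if_neg (htj.le.trans h.1.1).not_gt, if_neg (h.1.1.trans his.le).not_gt]
      simp
    · rw [if_neg h, if_neg (fun h' => h h'.symm)]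
  · rw [stepMatrix_mul, stepMatrix_mul, stepMatrix_mul, stepExp_add_comm p i j s t,
      stepExp_add_cross p i j s t]
    by_cases h : (j ≤ i ∧ j ≠ Fin.last n) ∧ (t ≤ s ∧ t ≠ Fin.last n)
    · rw [if_pos h, if_pos h.symm, if_pos his, if_neg his.not_gt, if_pos hjt, if_neg hjt.not_gt,
        if_neg (h.1.1.trans his.le).not_gt]
      -- If `t ≤ i`, the scalars satisfy `q ^ 2 = 1 + (q - q⁻¹) * q`. Otherwise the correction term
      -- is zero, and the exponent `1 - 2 + 1 = 0` makes the two entries commute.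
      by_cases hti : t ≤ i
      · have h' : (t ≤ i ∧ t ≠ Fin.last n) ∧ (j ≤ s ∧ j ≠ Fin.last n) :=
          ⟨⟨hti, h.2.2⟩, ⟨h.1.1.trans his.le, h.1.2⟩⟩
        rw [if_pos h', if_neg h.1.1.not_gt, if_neg hti.not_gt, smul_smul, ← add_smul]
        congr 1
        norm_num
        rw [sub_mul, inv_mul_cancel₀ hq]
        ring
      · have h' : ¬((t ≤ i ∧ t ≠ Fin.last n) ∧ (j ≤ s ∧ j ≠ Fin.last n)) := fun h' => hti h'.1.1
        rw [if_neg h', if_pos (not_le.1 hti)]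
        norm_num
    · rw [if_neg h, if_neg (fun h' => h h'.symm), if_neg, zero_add, smul_zero]
      rintro ⟨⟨h1, h2⟩, ⟨h3, h4⟩⟩
      exact h ⟨⟨hjt.le.trans h1, h4⟩, ⟨h1.trans his.le, h2⟩⟩

/-- A quantum matrix, extended by a row with a single entry in a new last column. -/
theorem IsQuantumMatrix.add_single {m : Fin n} {X : Matrix (Fin n) (Fin (n + 1)) B}
    (hX : IsQuantumMatrix q X) (hcol : ∀ i, X i (Fin.last n) = 0)
    (hrow : ∀ i, m ≤ i → ∀ k, X i k = 0) :
    IsQuantumMatrix q (X + Matrix.single m (Fin.last n) 1) := by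
  have hY : ∀ i k, (X + Matrix.single m (Fin.last n) 1 : Matrix (Fin n) (Fin (n + 1)) B) i k
      = if k = Fin.last n then (if i = m then 1 else 0) else X i k := by
    intro i k
    by_cases hk : k = Fin.last n
    · subst hk
      simp [hcol, Matrix.single_apply, eq_comm]
    · simp [hk, eq_comm (a := Fin.last n)]
  refine ⟨fun i j k hjk => ?_, fun i k j hik => ?_, fun i j s t his htj => ?_,
    fun i j s t his hjt => ?_⟩ <;> simp only [hY]
  · rw [if_neg (hjk.trans_le (Fin.le_last k)).ne]
    split_ifs with h1 h2
    · simp [hrow i h2.ge]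
    · simp
    · exact hX.row i j k hjk
  · split_ifs with h1 h2 h3
    · exact absurd (h2.trans h3.symm) hik.ne
    all_goals first | exact hX.col i k j hik | simp
  · rw [if_neg (htj.trans_le (Fin.le_last j)).ne]
    split_ifs with h1 h2
    · simp
    · simp
    · exact hX.anti i j s t his htj
  · simp only [(hjt.trans_le (Fin.le_last t)).ne, if_false]
    by_cases h1 : t = Fin.last n
    -- For `i = m` the correction term is `(q - q⁻¹) • X s j`, which vanishes because `s` is a row
    -- after `m`.
    · by_cases h2 : i = m
      · simp [h1, h2 ▸ his.ne', h2, hrow s (h2 ▸ his.le)]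
      · simp [h1, h2]
    · simpa only [h1, if_false] using hX.diag i j s t his hjt

/-- The stepwise construction of a quantum matrix whose first `m` rows have independent leading
exponents. -/
theorem exists_torus_quantumMatrix (hq : q ≠ 0) (T : QuantumTorus q (pathForm n) B) (m : ℕ)
    (hm : m ≤ n) :
    ∃ (X : Matrix (Fin n) (Fin (n + 1)) B) (v : Fin n → Fin (n + 1) → PathIndex n → ℤ),
      IsQuantumMatrix q X ∧ (∀ i, X i (Fin.last n) = 0) ∧
      (∀ i : Fin n, m ≤ (i : ℕ) → ∀ k, X i k = 0) ∧
      (∀ i k u, (∀ p : Fin n, (p : ℕ) < m → ∀ a, u (p, a) = 0) → Commute (X i k) (T.op u)) ∧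
      (∀ i : Fin n, (i : ℕ) < m → ∀ j, j ≠ Fin.last n →
        HasLead T (pathWeight n) (X i j) (v i j)) ∧
      (∀ i : Fin n, (i : ℕ) < m → ∀ j k p, v i j (p, Sum.inr k)
        = if j = k ∧ i ≤ p ∧ (p : ℕ) < m then 1 else 0) ∧
      (∀ i : Fin n, (i : ℕ) < m → ∀ j k, j ≤ k →
        pathWeight n (v i k) ≤ pathWeight n (v i j)) := by
  -- The commutation clause says that only variables of blocks `p < m` occur, so the next factor
  -- commutes with `X`. The right exponents will give independence, and monotonicity of weights
  -- along a row identifies the leading term after the next multiplication.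
  induction m with
  | zero =>
    refine ⟨0, 0, ⟨?_, ?_, ?_, ?_⟩, ?_, ?_, ?_, ?_, ?_, ?_⟩ <;> simp
  | succ m ih =>
    obtain ⟨X, v, hX, hcol, hrow, hcomm, hlead, hv, hmono⟩ := ih (by omega)
    set M : Fin n := ⟨m, hm⟩ with hM
    have hMi : ∀ i : Fin n, M ≤ i ↔ m ≤ (i : ℕ) := fun i => Iff.rfl
    have hX' := hX.add_single hcol (fun i hi => hrow i hi) (m := M)
    have hentry : ∀ i j, ((X + Matrix.single M (Fin.last n) 1) * stepMatrix T M :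
        Matrix (Fin n) (Fin (n + 1)) B) i j
        = ∑ k : Fin (n + 1), X i k * stepMatrix T M k j
          + if i = M then stepMatrix T M (Fin.last n) j else 0 := by
      intro i j
      rw [Matrix.add_mul, Matrix.add_apply, Matrix.mul_apply]
      congr 1
      split_ifs with h
      · subst h
        simp
      · rw [Matrix.single_mul_apply_of_ne _ _ _ _ _ h]
    have hT : ∀ k j u, (∀ a, u (M, a) = 0) → Commute (stepMatrix T M k j) (T.op u) := by
      intro k j u hu
      rw [stepMatrix, Matrix.of_apply]
      split_ifs
      · rw [Commute, SemiconjBy, T.op_mul, T.op_mul, pathForm_stepExp_left _ _ _ hu,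
          pathForm_stepExp_right _ _ _ hu, add_comm u]
      · exact Commute.zero_left _
    -- The unit in the spare last column makes the new row `M` equal to the last row of the step
    -- matrix; the zero last column of the step matrix frees that column again.
    refine ⟨(X + Matrix.single M (Fin.last n) 1) * stepMatrix T M,
      fun i j => if i = M then stepExp M (Fin.last n) j else v i j + stepExp M j j,
      hX'.mul hq (isQuantumMatrix_stepMatrix hq T M) ?_, ?_, ?_, ?_, ?_, ?_, ?_⟩
    · intro i k l j
      rw [Matrix.add_apply]
      refine Commute.add_left ?_ ?_
      · rw [stepMatrix, Matrix.of_apply]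
        split_ifs
        · refine hcomm _ _ _ fun p hp a => ?_
          have hne : p ≠ M := fun h => by simp [h, hM] at hp
          simp [stepExp, hne]
        · exact Commute.zero_right _
      · rw [Matrix.single_apply]
        split_ifs
        · exact Commute.one_left _
        · exact Commute.zero_left _
    · intro i
      rw [hentry]
      simp [stepMatrix]
    · intro i hi k
      have hne : i ≠ M := fun h => by simp [h, hM] at hi
      rw [hentry, if_neg hne, add_zero]
      exact Finset.sum_eq_zero fun l _ => by rw [hrow i (by omega), zero_mul]
    · intro i k u hu
      have hu' := hu M (Nat.lt_succ_self m)
      rw [hentry]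
      refine Commute.add_left (Commute.sum_left _ _ _ fun l _ => Commute.mul_left ?_ ?_) ?_
      · exact hcomm _ _ _ fun p hp => hu p (by omega)
      · exact hT _ _ _ hu'
      · split_ifs
        · exact hT _ _ _ hu'
        · exact Commute.zero_left _
    · intro i hi j hj
      rw [hentry]
      dsimp only
      by_cases h : i = M
      · rw [if_pos h, if_pos h, Finset.sum_eq_zero, zero_add, stepMatrix, Matrix.of_apply,
          if_pos ⟨Fin.le_last j, hj⟩]
        · exact HasLead.op T _ _
        · intro k _
          rw [hrow i (by simp [h, hM]), zero_mul]
      · have him : (i : ℕ) < m := by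
          have : (i : ℕ) ≠ m := fun e => h (Fin.ext e)
          omega
        rw [if_neg h, if_neg h, add_zero, ← Finset.add_sum_erase _ _ (Finset.mem_univ j)]
        -- The term `k = j` leads: triangularity leaves only `k ≥ j`, and for `k > j` the weight of
        -- `v i k` is no larger while the step contributes `-k < -j`.
        refine HasLead.add_lower ?_ (Submodule.sum_mem _ fun k hk => ?_)
        · rw [stepMatrix, Matrix.of_apply, if_pos ⟨le_rfl, hj⟩]
          exact (hlead i him j hj).mul hq (HasLead.op T _ _)
        · have hkj := Finset.ne_of_mem_erase hk
          rw [stepMatrix, Matrix.of_apply]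
          split_ifs with hc
          · by_cases hl : k = Fin.last n
            · rw [hl, hcol, zero_mul]
              exact Submodule.zero_mem _
            · refine ((hlead i him k hl).mul hq (HasLead.op T _ _)).mem_lower ?_
              rw [map_add, map_add, pathWeight_stepExp, pathWeight_stepExp]
              have h1 := hmono i him j k hc.1
              have h2 : (j : ℕ) < k := lt_of_le_of_ne hc.1 (fun e => hkj (Fin.ext e.symm))
              omega
          · rw [mul_zero]
            exact Submodule.zero_mem _
    · intro i hi j k p
      dsimp only
      by_cases h : i = M
      · rw [if_pos h]
        have hp : (p = M ∧ k = j) ↔ (j = k ∧ i ≤ p ∧ (p : ℕ) < m + 1) := by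
          rw [h, hMi, Fin.ext_iff (a := p)]
          simp only [hM]
          constructor
          · rintro ⟨h1, rfl⟩
            exact ⟨rfl, by omega, by omega⟩
          · rintro ⟨rfl, h1, h2⟩
            exact ⟨by omega, rfl⟩
        simp only [← hp]
        simp [stepExp, Pi.single_apply]
      · have him : (i : ℕ) < m := by
          have : (i : ℕ) ≠ m := fun e => h (Fin.ext e)
          omega
        rw [if_neg h, Pi.add_apply, hv i him]
        simp only [stepExp, Pi.add_apply, Pi.single_apply, Prod.mk.injEq, reduceCtorEq, and_false,
          if_false, zero_add, Sum.inr.injEq, Fin.ext_iff, Fin.le_def, hM]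
        split_ifs <;> omega
    · intro i hi j k hjk
      dsimp only
      have hjk' : (j : ℕ) ≤ k := hjk
      split_ifs with h
      · rw [pathWeight_stepExp, pathWeight_stepExp]
      · have him : (i : ℕ) < m := by
          have : (i : ℕ) ≠ m := fun e => h (Fin.ext e)
          omega
        have := hmono i him j k hjk
        rw [map_add, map_add, pathWeight_stepExp, pathWeight_stepExp]
        omega

end TorusModel

/-! ### Linear independence of ordered monomials -/

section OrderedMonomials

theorem QMatrixAlgebra.exists_algHom {K : Type*} [Field K] {n : ℕ} {q : K} {B : Type*} [Ring B]
    [Algebra K B] {X : Matrix (Fin n) (Fin n) B} (hX : IsQuantumMatrix q X) :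
    ∃ φ : QMatrixAlgebra n q →ₐ[K] B, ∀ p, φ (QMatrixAlgebra.gen n q p) = X p.1 p.2 := by
  refine ⟨RingQuot.liftAlgHom K ⟨FreeAlgebra.lift K fun p => X p.1 p.2, ?_⟩, fun p => ?_⟩
  · intro x y h
    cases h with
    | row i j k hjk => simpa using hX.row i j k hjk
    | col i k j hik => simpa using hX.col i k j hik
    | anti i j s t his htj => simpa using hX.anti i j s t his htj
    | diag i j s t his hjt => simpa using hX.diag i j s t his hjt
  · simp [QMatrixAlgebra.gen]

/-- Monomials in distinct generators, in any fixed order, are linearly independent. -/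
theorem QMatrixAlgebra.linearIndependent_monomials {K : Type*} [Field K] {n : ℕ} {q : K}
    (hq : q ≠ 0) {r : ℕ} {e : Fin r → Fin n × Fin n} (he : Function.Injective e) :
    LinearIndependent K fun α : Fin r → ℕ =>
      (List.ofFn fun k => QMatrixAlgebra.gen n q (e k) ^ α k).prod := by
  obtain ⟨B, _, _, ⟨T⟩⟩ := exists_quantumTorus hq (pathForm n)
  obtain ⟨X, v, hX, -, -, -, hlead, hv, -⟩ := exists_torus_quantumMatrix hq T n le_rfl
  have hX' : IsQuantumMatrix q (X.submatrix id Fin.castSucc) :=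
    ⟨fun i j k h => hX.row _ _ _ (Fin.castSucc_lt_castSucc_iff.2 h), fun i k j h => hX.col _ _ _ h,
      fun i j s t h h' => hX.anti _ _ _ _ h (Fin.castSucc_lt_castSucc_iff.2 h'),
      fun i j s t h h' => hX.diag _ _ _ _ h (Fin.castSucc_lt_castSucc_iff.2 h')⟩
  obtain ⟨φ, hφ⟩ := QMatrixAlgebra.exists_algHom hX'
  refine LinearIndependent.of_comp φ.toLinearMap ?_
  refine HasLead.linearIndependent (t := T) (w := pathWeight n)
    (v := fun α => ∑ k, α k • v (e k).1 (e k).2.castSucc) ?_ fun α => ?_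
  · intro α α' h
    have hsum : ∀ (p : Fin n) (j : Fin n) (α : Fin r → ℕ),
        (∑ k, α k • v (e k).1 (e k).2.castSucc) (p, Sum.inr j.castSucc)
          = ∑ k, if (e k).2 = j ∧ (e k).1 ≤ p then (α k : ℤ) else 0 := by
      intro p j α
      rw [Finset.sum_apply]
      refine Finset.sum_congr rfl fun k _ => ?_
      simp [hv]
    ext k
    -- The exponent of `r p j` sums the `α` of the letters in column `j` and rows up to `p`. Rows
    -- above `p` are known by induction, and injectivity of `e` leaves a single unknown in row `p`.
    induction hp : ((e k).1 : ℕ) using Nat.strong_induction_on generalizing k with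
    | _ p ih =>
      have h1 := congrFun h ((e k).1, Sum.inr (e k).2.castSucc)
      simp only [hsum] at h1
      rw [← Finset.add_sum_erase _ _ (Finset.mem_univ k),
        ← Finset.add_sum_erase _ _ (Finset.mem_univ k)] at h1
      have h2 : ∀ l ∈ Finset.univ.erase k,
          (if (e l).2 = (e k).2 ∧ (e l).1 ≤ (e k).1 then (α l : ℤ) else 0)
            = if (e l).2 = (e k).2 ∧ (e l).1 ≤ (e k).1 then (α' l : ℤ) else 0 := by
        intro l hl
        split_ifs with hc
        · have hne : (e l).1 ≠ (e k).1 := fun h' =>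
            Finset.ne_of_mem_erase hl (he (Prod.ext h' hc.1))
          have hlt : ((e l).1 : ℕ) < p := hp ▸ Fin.lt_def.1 (lt_of_le_of_ne hc.2 hne)
          exact_mod_cast ih _ hlt l rfl
        · rfl
      rw [Finset.sum_congr rfl h2] at h1
      have h3 := add_right_cancel h1
      simpa using h3
  · simp only [Function.comp_apply, AlgHom.toLinearMap_apply, map_list_prod, List.map_ofFn]
    refine HasLead.prod_ofFn hq fun k => ?_
    simp only [Function.comp_apply, map_pow, hφ]
    exact (hlead _ (e k).1.2 _ (Fin.castSucc_lt_last _).ne).pow hq _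

end OrderedMonomials

/-! ### Growth of the quantized matrix algebra -/

section Growth

namespace QMatrixAlgebra

variable {K : Type*} [Field K] {n : ℕ} {q : K}

theorem isQuantumMatrix_gen :
    IsQuantumMatrix q (Matrix.of fun i j => QMatrixAlgebra.gen n q (i, j)) := by
  refine ⟨fun i j k h => ?_, fun i k j h => ?_, fun i j s t h h' => ?_, fun i j s t h h' => ?_⟩ <;>
    simp only [Matrix.of_apply, gen, ← map_mul, ← map_smul, ← map_add]
  · exact RingQuot.mkAlgHom_rel K (QMatrixRel.row i j k h)
  · exact RingQuot.mkAlgHom_rel K (QMatrixRel.col i k j h)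
  · exact RingQuot.mkAlgHom_rel K (QMatrixRel.anti i j s t h h')
  · exact RingQuot.mkAlgHom_rel K (QMatrixRel.diag i j s t h h')

/-- The product of the generators with the given labels. -/
def word (q : K) (l : List (Fin n × Fin n)) : QMatrixAlgebra n q :=
  (l.map (gen n q)).prod

theorem word_cons (q : K) (a : Fin n × Fin n) (l : List (Fin n × Fin n)) :
    word q (a :: l) = gen n q a * word q l := by
  simp [word]

/-- A weight that drops in the correction terms of the defining relations. -/
def wordWeight (l : List (Fin n × Fin n)) : ℕ :=
  (l.map fun p => (p.1 : ℕ) * p.2).sum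

theorem wordWeight_cons (a : Fin n × Fin n) (l : List (Fin n × Fin n)) :
    wordWeight (a :: l) = (a.1 : ℕ) * a.2 + wordWeight l := by
  simp [wordWeight]

/-- The difference of the two sides is `(s - i) * (t - j)`. -/
theorem cross_weight_lt {i j s t : Fin n} (h : i < s) (h' : j < t) :
    (i : ℕ) * t + s * j < i * j + s * t := by
  obtain ⟨a, ha⟩ := Nat.exists_eq_add_of_lt (Fin.lt_def.1 h)
  obtain ⟨c, hc⟩ := Nat.exists_eq_add_of_lt (Fin.lt_def.1 h')
  rw [ha, hc]
  nlinarith [Nat.zero_le (a * c)]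

theorem gen_mul_gen (hq : q ≠ 0) (a b : Fin n × Fin n) :
    ∃ (c h : K) (a' b' : Fin n × Fin n),
      (h = 0 ∨ (a'.1 : ℕ) * a'.2 + b'.1 * b'.2 < a.1 * a.2 + b.1 * b.2) ∧
      gen n q a * gen n q b = c • (gen n q b * gen n q a) + h • (gen n q a' * gen n q b') := by
  obtain ⟨i, j⟩ := a
  obtain ⟨s, t⟩ := b
  have hX := isQuantumMatrix_gen (n := n) (q := q)
  rcases lt_trichotomy i s with his | rfl | his <;> rcases lt_trichotomy j t with hjt | rfl | hjt
  · exact ⟨1, q - q⁻¹, (i, t), (s, j), Or.inr (cross_weight_lt his hjt), by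
      simpa using hX.diag i j s t his hjt⟩
  -- When `h = 0`, the letters `a'` and `b'` are placeholders.
  · exact ⟨q, 0, (i, j), (i, j), Or.inl rfl, by simpa using hX.col i s j his⟩
  · exact ⟨1, 0, (i, j), (i, j), Or.inl rfl, by simpa using hX.anti i j s t his hjt⟩
  · exact ⟨q, 0, (i, j), (i, j), Or.inl rfl, by simpa using hX.row i j t hjt⟩
  · exact ⟨1, 0, (i, j), (i, j), Or.inl rfl, by simp⟩
  · refine ⟨q⁻¹, 0, (i, j), (i, j), Or.inl rfl, ?_⟩
    have := hX.row i t j hjt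
    simp only [Matrix.of_apply] at this
    rw [this, smul_smul, inv_mul_cancel₀ hq]
    simp
  · exact ⟨1, 0, (i, j), (i, j), Or.inl rfl, by simpa using (hX.anti s t i j his hjt).symm⟩
  · refine ⟨q⁻¹, 0, (i, j), (i, j), Or.inl rfl, ?_⟩
    have := hX.col s i j his
    simp only [Matrix.of_apply] at this
    rw [this, smul_smul, inv_mul_cancel₀ hq]
    simp
  · refine ⟨1, -(q - q⁻¹), (s, j), (i, t), Or.inr ?_, ?_⟩
    · have := cross_weight_lt his hjt
      simp only
      omega
    · have := hX.diag s t i j his hjt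
      simp only [Matrix.of_apply] at this
      rw [this, one_smul, add_assoc, ← add_smul, add_neg_cancel, zero_smul, add_zero]

/-- The span of the words of length `N` and of weight less than `d`. -/
def lowerWords (q : K) (N d : ℕ) : Submodule K (QMatrixAlgebra n q) :=
  Submodule.span K (word q '' {l : List (Fin n × Fin n) | l.length = N ∧ wordWeight l < d})

theorem gen_mul_mem_lowerWords {N d : ℕ} (a : Fin n × Fin n) {x : QMatrixAlgebra n q}
    (hx : x ∈ lowerWords q N d) : gen n q a * x ∈ lowerWords q (N + 1) ((a.1 : ℕ) * a.2 + d) := by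
  have h : lowerWords q N d ≤ (lowerWords q (N + 1) ((a.1 : ℕ) * a.2 + d)).comap
      (LinearMap.mulLeft K (gen n q a)) := by
    refine Submodule.span_le.2 ?_
    rintro _ ⟨l, ⟨hl, hw⟩, rfl⟩
    refine Submodule.subset_span ⟨a :: l, ⟨by simp [hl], ?_⟩, by simp [word_cons]⟩
    rw [wordWeight_cons]
    omega
  exact h hx

theorem wordWeight_perm {l l' : List (Fin n × Fin n)} (h : l.Perm l') :
    wordWeight l = wordWeight l' :=
  (h.map _).sum_eq

/-- An adjacent swap costs a scalar and a word of equal length and smaller weight; prefixing a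
letter shifts all weights equally, and permuting preserves the weight, so the errors accumulate
inside one space. -/
theorem word_perm (hq : q ≠ 0) {l l' : List (Fin n × Fin n)} (h : l.Perm l') :
    ∃ c : K, word q l - c • word q l' ∈ lowerWords q l.length (wordWeight l) := by
  induction h with
  | nil => exact ⟨1, by simp⟩
  | cons a h ih =>
    obtain ⟨c, hc⟩ := ih
    refine ⟨c, ?_⟩
    have := gen_mul_mem_lowerWords a hc
    rwa [mul_sub, mul_smul_comm, ← word_cons, ← word_cons, ← wordWeight_cons,
      ← List.length_cons (a := a)] at this
  | swap a b l =>
    obtain ⟨c, h, a', b', hh, he⟩ := gen_mul_gen hq b a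
    refine ⟨c, ?_⟩
    have : word q (b :: a :: l) - c • word q (a :: b :: l) = h • word q (a' :: b' :: l) := by
      simp only [word_cons, ← mul_assoc]
      rw [he, add_mul, smul_mul_assoc, smul_mul_assoc]
      abel
    rw [this]
    rcases hh with rfl | hh
    · rw [zero_smul]
      exact Submodule.zero_mem _
    · refine Submodule.smul_mem _ _ (Submodule.subset_span ⟨_, ⟨by simp, ?_⟩, rfl⟩)
      simp only [wordWeight_cons]
      omega
  | trans h₁ h₂ ih₁ ih₂ =>
    obtain ⟨c, hc⟩ := ih₁
    obtain ⟨c', hc'⟩ := ih₂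
    refine ⟨c * c', ?_⟩
    rw [← h₁.length_eq, ← wordWeight_perm h₁] at hc'
    have := Submodule.add_mem _ hc (Submodule.smul_mem _ c hc')
    rwa [smul_sub, smul_smul, sub_add_sub_cancel] at this

/-- Words with one fixed ordering for each multiset of letters span. -/
theorem word_mem_span (hq : q ≠ 0) (l : List (Fin n × Fin n)) :
    word q l ∈ Submodule.span K ((fun s : Multiset (Fin n × Fin n) => word q s.toList) ''
      {s | s.card = l.length}) := by
  induction hd : wordWeight l using Nat.strong_induction_on generalizing l with
  | _ d ih =>
    have hp : l.Perm (l : Multiset (Fin n × Fin n)).toList :=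
      Multiset.coe_eq_coe.1 (Multiset.coe_toList _).symm
    obtain ⟨c, hc⟩ := word_perm hq hp
    have hle : lowerWords q l.length (wordWeight l) ≤ Submodule.span K
        ((fun s : Multiset (Fin n × Fin n) => word q s.toList) '' {s | s.card = l.length}) := by
      refine Submodule.span_le.2 ?_
      rintro _ ⟨l', ⟨hl, hw⟩, rfl⟩
      have := ih _ (hd ▸ hw) l' rfl
      rwa [hl] at this
    have := Submodule.add_mem _ (hle hc) (Submodule.smul_mem _ c (Submodule.subset_span
      ⟨(l : Multiset (Fin n × Fin n)), by simp, rfl⟩))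
    simpa using this

/-- The span of `1` and the generators. -/
def genSpan (n : ℕ) (q : K) : Submodule K (QMatrixAlgebra n q) :=
  Submodule.span K (insert 1 (Set.range (gen n q)))

theorem one_mem_genSpan : (1 : QMatrixAlgebra n q) ∈ genSpan n q :=
  Submodule.subset_span (Set.mem_insert _ _)

theorem gen_mem_genSpan (p : Fin n × Fin n) : gen n q p ∈ genSpan n q :=
  Submodule.subset_span (Set.mem_insert_of_mem _ ⟨p, rfl⟩)

theorem genSpan_fg : (genSpan n q).FG :=
  Submodule.fg_span ((Set.finite_range _).insert _)

theorem genSpan_pow_mono {d d' : ℕ} (h : d ≤ d') : genSpan n q ^ d ≤ genSpan n q ^ d' := by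
  obtain ⟨k, rfl⟩ := Nat.exists_eq_add_of_le h
  intro x hx
  have h1 := Submodule.pow_mem_pow _ (one_mem_genSpan (n := n) (q := q)) k
  rw [one_pow] at h1
  rw [pow_add]
  simpa using Submodule.mul_mem_mul hx h1

open scoped Pointwise in
theorem genSpan_pow_le_words (d : ℕ) :
    genSpan n q ^ d ≤ Submodule.span K (word q '' {l | l.length ≤ d}) := by
  rw [genSpan, Submodule.span_pow]
  refine Submodule.span_mono ?_
  induction d with
  | zero =>
    rw [pow_zero]
    rintro _ rfl
    exact ⟨[], by simp, by simp [word]⟩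
  | succ d ih =>
    rw [pow_succ]
    rintro _ ⟨x, hx, y, hy, rfl⟩
    obtain ⟨l, hl, rfl⟩ := ih hx
    simp only [Set.mem_ofPred_eq] at hl
    rcases hy with rfl | ⟨p, rfl⟩
    · exact ⟨l, hl.trans (Nat.le_succ d), by simp⟩
    · exact ⟨l ++ [p], by simpa using hl, by simp [word]⟩

/-- The dimension of the span of words of length at most `d` is at most `(d + 1) ^ (n ^ 2)`. -/
theorem finrank_genSpan_pow_le (hq : q ≠ 0) (d : ℕ) :
    Module.finrank K (genSpan n q ^ d : Submodule K (QMatrixAlgebra n q)) ≤ (d + 1) ^ (n ^ 2) := by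
  -- A multiset of at most `d` letters is given by its multiplicities, each at most `d`.
  let f : (Fin n × Fin n → Fin (d + 1)) → QMatrixAlgebra n q := fun α =>
    word q (∑ p, (α p : ℕ) • ({p} : Multiset (Fin n × Fin n))).toList
  have hle : genSpan n q ^ d ≤ Submodule.span K (Set.range f) := by
    refine (genSpan_pow_le_words d).trans (Submodule.span_le.2 ?_)
    rintro _ ⟨l, hl, rfl⟩
    refine Submodule.span_mono ?_ (word_mem_span hq l)
    rintro _ ⟨s, hs, rfl⟩
    simp only [Set.mem_ofPred_eq] at hs hl
    refine ⟨fun p => ⟨s.count p, Nat.lt_succ_of_le ((s.count_le_card p).trans (hs ▸ hl))⟩, ?_⟩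
    simp only [f]
    congr 2
    ext p
    simp [Multiset.count_sum', Multiset.count_singleton]
  have : Module.Finite K (Submodule.span K (Set.range f)) :=
    Module.Finite.span_of_finite K (Set.finite_range f)
  refine (Submodule.finrank_mono hle).trans ((finrank_range_le_card f).trans ?_)
  simp [sq]

theorem exists_mem_genSpan_pow (x : QMatrixAlgebra n q) : ∃ d, x ∈ genSpan n q ^ d := by
  obtain ⟨x, rfl⟩ := RingQuot.mkAlgHom_surjective K (QMatrixRel n q) x
  induction x using FreeAlgebra.induction with
  | grade0 r =>
    refine ⟨0, ?_⟩
    rw [AlgHom.commutes, pow_zero]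
    exact Submodule.algebraMap_mem r
  | grade1 p => exact ⟨1, (pow_one (genSpan n q)).symm ▸ gen_mem_genSpan p⟩
  | mul a b ha hb =>
    obtain ⟨d, hd⟩ := ha
    obtain ⟨d', hd'⟩ := hb
    refine ⟨d + d', ?_⟩
    rw [map_mul, pow_add]
    exact Submodule.mul_mem_mul hd hd'
  | add a b ha hb =>
    obtain ⟨d, hd⟩ := ha
    obtain ⟨d', hd'⟩ := hb
    refine ⟨max d d', ?_⟩
    rw [map_add]
    exact Submodule.add_mem _ (genSpan_pow_mono (le_max_left _ _) hd)
      (genSpan_pow_mono (le_max_right _ _) hd')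

/-- This reduces the supremum over all `V` to powers of the single subspace `genSpan`. -/
theorem exists_le_genSpan_pow {V : Submodule K (QMatrixAlgebra n q)} (hV : V.FG) :
    ∃ d, V ≤ genSpan n q ^ d := by
  induction V, hV using Submodule.fg_induction with
  | singleton x =>
    obtain ⟨d, hd⟩ := exists_mem_genSpan_pow x
    exact ⟨d, by simpa using hd⟩
  | sup V V' _ _ hV hV' =>
    obtain ⟨d, hd⟩ := hV
    obtain ⟨d', hd'⟩ := hV'
    exact ⟨max d d', sup_le (hd.trans (genSpan_pow_mono (le_max_left _ _)))
      (hd'.trans (genSpan_pow_mono (le_max_right _ _)))⟩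

end QMatrixAlgebra

end Growth

/-! ### Gelfand-Kirillov dimension -/

section GelfandKirillov

open Filter Topology

/-- The constant is invisible in the limit, since `log C / log d` tends to `0`. -/
theorem limsup_log_div_log_le {f : ℕ → ℕ} {N C : ℕ} (hC : 0 < C)
    (hf : ∀ d, 1 ≤ d → f d ≤ (C * d) ^ N) :
    limsup (fun d : ℕ => ENNReal.log (f d : ENNReal) / ((Real.log d : ℝ) : EReal)) atTop
      ≤ (N : EReal) := by
  have hlog : Tendsto (fun d : ℕ => Real.log (d : ℝ)) atTop atTop :=
    Real.tendsto_log_atTop.comp tendsto_natCast_atTop_atTop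
  have hreal : Tendsto (fun d : ℕ => (N : ℝ) * (Real.log C / Real.log d + 1)) atTop
      (𝓝 (N : ℝ)) := by
    have := ((tendsto_const_nhds (x := Real.log C)).div_atTop hlog).add_const 1
    simpa using this.const_mul (N : ℝ)
  have hlim : Tendsto (fun d : ℕ => (((N : ℝ) * (Real.log C / Real.log d + 1) : ℝ) : EReal)) atTop
      (𝓝 ((N : ℝ) : EReal)) := (continuous_coe_real_ereal.tendsto _).comp hreal
  have hle : limsup (fun d : ℕ => ENNReal.log (f d : ENNReal) / ((Real.log d : ℝ) : EReal)) atTop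
      ≤ limsup (fun d : ℕ => (((N : ℝ) * (Real.log C / Real.log d + 1) : ℝ) : EReal)) atTop := by
    refine limsup_le_limsup ?_
    filter_upwards [eventually_ge_atTop 2] with d hd
    have hd0 : 0 < Real.log d := Real.log_pos (by exact_mod_cast hd)
    have hCd : ((C * d : ℕ) : ENNReal) ≠ 0 := by
      exact_mod_cast (Nat.mul_pos hC (by omega)).ne'
    have h1 : ENNReal.log (f d : ENNReal) ≤ (((N : ℝ) * (Real.log C + Real.log d) : ℝ) : EReal) := by
      have : (f d : ENNReal) ≤ ((C * d : ℕ) : ENNReal) ^ N := by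
        exact_mod_cast hf d (by omega)
      refine (ENNReal.log_monotone this).trans ?_
      rw [ENNReal.log_pow, ENNReal.log_pos_real hCd (ENNReal.natCast_ne_top _),
        ENNReal.toReal_natCast, Nat.cast_mul, Real.log_mul (by exact_mod_cast hC.ne')
        (by exact_mod_cast (by omega : d ≠ 0)), EReal.coe_mul]
      rfl
    refine (EReal.div_le_div_right_of_nonneg (by exact_mod_cast hd0.le) h1).trans ?_
    rw [← EReal.coe_div]
    refine EReal.coe_le_coe_iff.2 (le_of_eq ?_)
    field_simp
  rw [hlim.limsup_eq] at hle
  exact hle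

theorem le_limsup_log_div_log {f : ℕ → ℕ} {r : ℕ} (hf : ∀ d, d ^ r ≤ f d) :
    (r : EReal)
      ≤ limsup (fun d : ℕ => ENNReal.log (f d : ENNReal) / ((Real.log d : ℝ) : EReal)) atTop := by
  refine le_limsup_of_frequently_le' (Eventually.frequently ?_)
  filter_upwards [eventually_ge_atTop 2] with d hd
  have hd0 : 0 < Real.log d := Real.log_pos (by exact_mod_cast hd)
  rw [EReal.le_div_iff_mul_le (by exact_mod_cast hd0) (EReal.coe_ne_top _)]
  have h : ((d : ENNReal)) ^ r ≤ (f d : ENNReal) := by exact_mod_cast hf d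
  refine le_trans (le_of_eq ?_) (ENNReal.log_monotone h)
  rw [ENNReal.log_pow, ENNReal.log_pos_real (by exact_mod_cast (by omega : d ≠ 0))
    (ENNReal.natCast_ne_top _), ENNReal.toReal_natCast]

variable {K : Type*} [Field K] {n : ℕ} {q : K}

/-- Finiteness matters because `finrank` is `0` on infinite-dimensional spaces. -/
theorem smulSpan_fg {A M : Type*} [Ring A] [Algebra K A] [AddCommGroup M] [Module K M]
    [Module A M] [IsScalarTower K A M] {W : Submodule K A} {F : Submodule K M} (hW : W.FG)
    (hF : F.FG) : (smulSpan W F).FG := by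
  have : SMulCommClass A K M := IsScalarTower.to_smulCommClass'
  have hle : smulSpan W F = Submodule.map₂ (Algebra.lsmul K K M).toLinearMap W F := by
    rw [Submodule.map₂_eq_span_image2, smulSpan]
    congr 1
    ext y
    simp only [Set.mem_image2, Set.mem_ofPred_eq, SetLike.mem_coe, eq_comm (a := y)]
    rfl
  rw [hle]
  exact hW.map₂ _ hF

open QMatrixAlgebra in
theorem gkDim_quotient_le (hq : q ≠ 0)
    (L : Submodule (QMatrixAlgebra n q) (QMatrixAlgebra n q)) :
    gkDim K (QMatrixAlgebra n q) (QMatrixAlgebra n q ⧸ L) ≤ ((n ^ 2 : ℕ) : EReal) := by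
  refine iSup_le fun V => iSup_le fun hV => iSup_le fun _ => iSup_le fun F => iSup_le fun hF => ?_
  obtain ⟨k, hk⟩ := exists_le_genSpan_pow hV
  have hF' : ∃ k', F ≤ (genSpan n q ^ k').map (L.mkQ.restrictScalars K) := by
    induction F, hF using Submodule.fg_induction with
    | singleton x =>
      obtain ⟨y, rfl⟩ := L.mkQ_surjective x
      obtain ⟨d, hd⟩ := exists_mem_genSpan_pow y
      refine ⟨d, ?_⟩
      rw [Submodule.span_singleton_le_iff_mem]
      exact ⟨y, hd, rfl⟩
    | sup F F' _ _ h h' =>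
      obtain ⟨d, hd⟩ := h
      obtain ⟨d', hd'⟩ := h'
      exact ⟨max d d', sup_le
        (hd.trans (Submodule.map_mono (genSpan_pow_mono (le_max_left _ _))))
        (hd'.trans (Submodule.map_mono (genSpan_pow_mono (le_max_right _ _))))⟩
  obtain ⟨k', hk'⟩ := hF'
  -- The space `V ^ d F` lies in the image of `genSpan ^ (k * d + k')`, and `k * d + k' + 1 ≤ (k +
  -- k' + 1) * d` for `d ≥ 1`.
  refine limsup_log_div_log_le (C := k + k' + 1) (Nat.succ_pos _) fun d hd => ?_
  have hle : smulSpan (V ^ d) F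
      ≤ (genSpan n q ^ (k * d + k')).map (L.mkQ.restrictScalars K) := by
    refine Submodule.span_le.2 ?_
    rintro _ ⟨w, hw, x, hx, rfl⟩
    obtain ⟨y, hy, rfl⟩ := hk' hx
    refine ⟨w * y, ?_, map_smul L.mkQ w y⟩
    rw [pow_add, pow_mul]
    exact Submodule.mul_mem_mul (pow_le_pow_left' hk d hw) hy
  have hfin : Module.Finite K (genSpan n q ^ (k * d + k') : Submodule K (QMatrixAlgebra n q)) :=
    Module.Finite.iff_fg.2 (genSpan_fg.pow _)
  have hfin' : Module.Finite K ((genSpan n q ^ (k * d + k')).map (L.mkQ.restrictScalars K)) :=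
    Module.Finite.iff_fg.2 ((genSpan_fg.pow _).map _)
  refine (Submodule.finrank_mono hle).trans ((Submodule.finrank_map_le _ _).trans
    ((finrank_genSpan_pow_le hq _).trans (Nat.pow_le_pow_left ?_ _)))
  nlinarith

theorem list_prod_ofFn_mem_pow {A : Type*} [Ring A] [Algebra K A] {V : Submodule K A} {r : ℕ}
    {x : Fin r → A} (hx : ∀ k, x k ∈ V) : (List.ofFn x).prod ∈ V ^ r := by
  induction r with
  | zero =>
    rw [List.ofFn_zero, List.prod_nil, pow_zero]
    exact Submodule.one_le.1 le_rfl
  | succ r ih =>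
    rw [List.ofFn_succ, List.prod_cons, pow_succ']
    exact Submodule.mul_mem_mul (hx 0) (ih fun k => hx k.succ)

open QMatrixAlgebra in
/-- If the span of the ordered monomials in `r` distinct generators meets `L` trivially, then the
quotient by `L` has dimension at least `r`. -/
theorem le_gkDim_quotient (hq : q ≠ 0)
    (L : Submodule (QMatrixAlgebra n q) (QMatrixAlgebra n q)) {r : ℕ}
    {e : Fin r → Fin n × Fin n} (he : Function.Injective e)
    (hL : orderedMonomialSpan K (fun k => gen n q (e k)) ⊓ L.restrictScalars K = ⊥) :
    (r : EReal) ≤ gkDim K (QMatrixAlgebra n q) (QMatrixAlgebra n q ⧸ L) := by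
  have h1 : (1 : QMatrixAlgebra n q) ∈ genSpan n q ^ r := by
    simpa using Submodule.pow_mem_pow _ (one_mem_genSpan (n := n) (q := q)) r
  have hF : (Submodule.span K {L.mkQ 1}).FG := Submodule.fg_span_singleton _
  -- With `genSpan ^ r` in place of `genSpan`, the `d`-th power contains every monomial in `r`
  -- generators with exponents below `d`, giving the bound `d ^ r` without constants.
  refine le_trans ?_ (le_iSup₂_of_le (genSpan n q ^ r) (genSpan_fg.pow r) (le_iSup₂_of_le h1
    (Submodule.span K {L.mkQ 1}) (le_iSup_of_le hF le_rfl)))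
  refine le_limsup_log_div_log fun d => ?_
  have hfin : Module.Finite K (smulSpan ((genSpan n q ^ r) ^ d) (Submodule.span K {L.mkQ 1})) :=
    Module.Finite.iff_fg.2 (smulSpan_fg ((genSpan_fg.pow r).pow d) hF)
  have hli : LinearIndependent K fun α : Fin r → ℕ =>
      L.mkQ (List.ofFn fun k => gen n q (e k) ^ α k).prod := by
    refine (linearIndependent_monomials hq he).map (f := L.mkQ.restrictScalars K) ?_
    rw [Submodule.disjoint_def]
    intro x hx hx'
    rw [← Submodule.mem_bot K, ← hL]
    refine ⟨hx, ?_⟩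
    simpa using hx'
  have hmem : ∀ α : Fin r → Fin d, L.mkQ (List.ofFn fun k => gen n q (e k) ^ (α k : ℕ)).prod
      ∈ smulSpan ((genSpan n q ^ r) ^ d) (Submodule.span K {L.mkQ 1}) := by
    intro α
    refine Submodule.subset_span ⟨_, ?_, L.mkQ 1, Submodule.mem_span_singleton_self _,
      by rw [← map_smul, smul_eq_mul, mul_one]⟩
    -- Regrouping as `(genSpan ^ d) ^ r` provides one factor for each generator.
    rw [← pow_mul, mul_comm, pow_mul]
    exact list_prod_ofFn_mem_pow fun k =>
      genSpan_pow_mono (α k).2.le (Submodule.pow_mem_pow _ (gen_mem_genSpan (e k)) _)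
  have hli' : LinearIndependent K fun α : Fin r → Fin d =>
      (⟨_, hmem α⟩ : smulSpan ((genSpan n q ^ r) ^ d) (Submodule.span K {L.mkQ 1})) := by
    refine LinearIndependent.of_comp (Submodule.subtype _) ?_
    exact hli.comp (fun (α : Fin r → Fin d) k => (α k : ℕ))
      fun α β h => funext fun k => Fin.ext (congrFun h k)
  simpa using hli'.fintype_card_le_finrank

end GelfandKirillov

end

theorem theorem3p5 {K : Type*} [Field K] [CharZero K] (n : ℕ) (hn : 2 ≤ n) (q : K) (hq : q ≠ 0)
    (e : Fin (n ^ 2) ≃ Fin n × Fin n) (z : Fin (n ^ 2) → QMatrixAlgebra n q)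
    (hz : ∀ k, z k = QMatrixAlgebra.gen n q (e k))
    (L : Submodule (QMatrixAlgebra n q) (QMatrixAlgebra n q)) :
    gkDim K (QMatrixAlgebra n q) (QMatrixAlgebra n q ⧸ L) ≤ ((n ^ 2 : ℕ) : EReal) ∧
    ∀ m : ℕ, gkDim K (QMatrixAlgebra n q) (QMatrixAlgebra n q ⧸ L) = (m : EReal) → m < n ^ 2 →
      (∀ i : Fin (m + 1) → Fin (n ^ 2), StrictMono i →
        orderedMonomialSpan K (fun k => z (i k)) ⊓ L.restrictScalars K ≠ ⊥) ∧
      (∀ (s : ℕ) (hs : s ≤ n ^ 2), m + 1 ≤ s →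
        orderedMonomialSpan K (fun k : Fin s => z (Fin.castLE hs k)) ⊓ L.restrictScalars K ≠ ⊥) := by
  obtain rfl : z = fun k => QMatrixAlgebra.gen n q (e k) := funext hz
  -- Both remaining claims are instances: a trivial intersection would give `r ≤ m`, and this needs
  -- only distinct generators.
  have key : ∀ (m r : ℕ) (i : Fin r → Fin (n ^ 2)), Function.Injective i → m < r →
      gkDim K (QMatrixAlgebra n q) (QMatrixAlgebra n q ⧸ L) = (m : EReal) →
      orderedMonomialSpan K (fun k => QMatrixAlgebra.gen n q (e (i k))) ⊓ L.restrictScalars K ≠ ⊥ := by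
    intro m r i hi hmr hm h
    have := le_gkDim_quotient hq L (e.injective.comp hi) h
    rw [hm] at this
    exact absurd hmr (not_lt.2 (by exact_mod_cast this))
  refine ⟨gkDim_quotient_le hq L, fun m hm _ => ⟨fun i hi => ?_, fun s hs hms => ?_⟩⟩
  · exact key m (m + 1) i hi.injective (Nat.lt_succ_self m) hm
  · exact key m s (Fin.castLE hs) (Fin.castLE_injective hs) hms hm
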